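/- Graphs are simple and undirected; "countable" includes finite (and empty), and existential formulas are formulas $\exists \bar y\,\psi$ with $\psi$ quantifier-free in the first-order language of graphs (adjacency and equality). Let $\mathcal C$ be a finite set of finite connected graphs (connected graphs are nonempty). Let $\mathcal G_{\mathcal C}$ be the class of countable graphs having no subgraph (induced or not) isomorphic to a member of $\mathcal C$, and let $\mathcal E_{\mathcal C}$ be the class of those $G\in\mathcal G_{\mathcal C}$ that are existentially complete: whenever $G$ is an induced subgraph of some $H\in\mathcal G_{\mathcal C}$, every existential formula with parameters from $G$ that is true in $H$ is true in $G$. A graph is universal in a class if it belongs to the class and every graph in the class is isomorphic to an induced subgraph of it. For $G\in\mathcal E_{\mathcal C}$ and $\bar a\in V(G)^n$, let $\mathrm{tp}_G(\bar a)$ be the set of existential formulas $\varphi(x_1,\dots,x_n)$ with $G\models\varphi(\bar a)$, and let $S_n(T^*_{\mathcal C})$ be the set of all $\mathrm{tp}_G(\bar a)$ with $G\in\mathcal E_{\mathcal C}$ and $\bar a\in V(G)^n$ (here $T^*_{\mathcal C}$ denotes the first-order theory of $\mathcal E_{\mathcal C}$). A graph $G\in\mathcal E_{\mathcal C}$ is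 $\aleph_0$-saturated if for all $n\ge 0$, all $\bar a\in V(G)^n$ and all $p\in S_{n+1}(T^*_{\mathcal C})$ whose restriction to the first $n$ variables is $\mathrm{tp}_G(\bar a)$, there is $v\in V(G)$ with $\mathrm{tp}_G(\bar a,v)=p$. Theorem. The following are equivalent: 1. There is a universal graph in $\mathcal G_{\mathcal C}$. 2. There is a universal graph in $\mathcal E_{\mathcal C}$. 3. $\mathcal E_{\mathcal C}$ contains a unique $\aleph_0$-saturated graph, up to isomorphism (that is, one exists and any two are isomorphic). 4. $S_n(T^*_{\mathcal C})$ is countable for every $n$. -/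

import Mathlib

open FirstOrder

namespace ForbiddenGraphs

/-! Graphs are simple graphs; the graphs under study are countable (finite and empty vertex sets
included), so there is no loss in taking their vertex types in `Type`.
A set of forbidden graphs is an indexed family `C : ∀ i, SimpleGraph (W i)`. -/

/-- `G ⊨ φ(a)`: the formula `φ(x₁, …, xₙ)` in the language of graphs (adjacency and equality)
holds in `G` at the tuple `a`. -/
def Sat {V : Type} (G : SimpleGraph V) {n : ℕ} (φ : Language.graph.Formula (Fin n))
    (a : Fin n → V) : Prop :=
  letI := G.structure
  φ.Realize a

/-- A formula `∃ y₁ … yₖ, ψ` with `ψ` quantifier-free. -/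
def IsExistential {n : ℕ} (φ : Language.graph.Formula (Fin n)) : Prop :=
  Language.BoundedFormula.IsExistential φ

/-- `G` is existentially complete in `H`, where `G` is identified with an induced subgraph of `H`
by `f`: existential statements with parameters in `G` that are true in `H` are true in `G`. -/
def ExistentiallyCompleteIn {V V' : Type} {G : SimpleGraph V} {H : SimpleGraph V'}
    (f : G ↪g H) : Prop :=
  ∀ (n : ℕ) (φ : Language.graph.Formula (Fin n)) (a : Fin n → V),
    IsExistential φ → Sat H φ (f ∘ a) → Sat G φ a

section

universe u w

variable {ι : Type u} {W : ι → Type w}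

/-- `G` omits `C`: no subgraph of `G` (induced or not) is isomorphic to a member of `C`. -/
def Omits (C : ∀ i, SimpleGraph (W i)) {V : Type} (G : SimpleGraph V) : Prop :=
  ∀ i, (C i).Free G

/-- The class `𝒢_C` of countable graphs omitting `C`. -/
def ClassG (C : ∀ i, SimpleGraph (W i)) {V : Type} (G : SimpleGraph V) : Prop :=
  Countable V ∧ Omits C G

/-- The class `ℰ_C` of graphs in `𝒢_C` that are existentially complete in every graph of `𝒢_C`
containing them as an induced subgraph. -/
def ClassE (C : ∀ i, SimpleGraph (W i)) {V : Type} (G : SimpleGraph V) : Prop :=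
  ClassG C G ∧ ∀ (V' : Type) (H : SimpleGraph V') (f : G ↪g H),
    ClassG C H → ExistentiallyCompleteIn f

/-- `G` is universal in the class `K`: it belongs to `K`, and every graph in `K` is isomorphic to
an induced subgraph of `G`. -/
def IsUniversalIn (K : ∀ {V : Type}, SimpleGraph V → Prop) {V : Type} (G : SimpleGraph V) : Prop :=
  K G ∧ ∀ (V' : Type) (H : SimpleGraph V'), K H → Nonempty (H ↪g G)

/-- The existential type `tp_G(a)` of a finite sequence in `G`. -/
def existentialType {V : Type} (G : SimpleGraph V) {n : ℕ} (a : Fin n → V) :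
    Set (Language.graph.Formula (Fin n)) :=
  {φ | IsExistential φ ∧ Sat G φ a}

/-- The space `S_n(T*_C)`: all existential types of sequences of length `n` in graphs of `ℰ_C`. -/
def typeSpace (C : ∀ i, SimpleGraph (W i)) (n : ℕ) : Set (Set (Language.graph.Formula (Fin n))) :=
  {p | ∃ (V : Type) (G : SimpleGraph V) (a : Fin n → V), ClassE C G ∧ p = existentialType G a}

/-- Restriction of an `(n+1)`-type to the first `n` variables. -/
def restrictType {n : ℕ} (p : Set (Language.graph.Formula (Fin (n + 1)))) :
    Set (Language.graph.Formula (Fin n)) :=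
  {φ | IsExistential φ ∧ φ.relabel Fin.castSucc ∈ p}

/-- `G` is an `ℵ₀`-saturated graph of `ℰ_C`. -/
def IsSaturated (C : ∀ i, SimpleGraph (W i)) {V : Type} (G : SimpleGraph V) : Prop :=
  ClassE C G ∧ ∀ (n : ℕ) (a : Fin n → V), ∀ p ∈ typeSpace C (n + 1),
    restrictType p = existentialType G a →
      ∃ v : V, existentialType G (Fin.snoc a v : Fin (n + 1) → V) = p

end

end ForbiddenGraphs

/-! The graphs of `ℰ_C` play the part of models of a complete theory: in them an existential type
is not changed by passing to a larger graph of `𝒢_C`. Both existentially complete and saturated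
extensions come out of one construction: if each of countably many requirements on tuples can be
met by one extension and is preserved by further ones, a direct limit of a chain of extensions meets
all of them at all its tuples. For saturation the requirements are the types, hence the
countability in (4), and a type over a tuple is realized by amalgamation: if the existential type of
`b` in `H` is contained in that of `a` in `G`, finite parts of `H` embed in `G` with `b` sent to
`a`, so that `H` embeds in an ultrapower of `G`, which omits the finite graphs of `C` as `G` does.

Back-and-forth then makes a saturated graph unique, and its forth half makes it universal. The
starting point is that all graphs of `ℰ_C` have the same existential sentences, because any two
graphs of `𝒢_C` embed in their disjoint union: a connected graph contained in a disjoint union is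
contained in one of its parts, so the union is again in `𝒢_C`. Conversely, a universal graph of
`ℰ_C` is countable and realizes every type. -/

namespace ForbiddenGraphs

section Formulas

open Language BoundedFormula

universe u v

variable {L : FirstOrder.Language.{u, v}} {α β : Type*} {n k : ℕ}

theorem isExistential_exs {φ : L.BoundedFormula α k} (hφ : φ.IsExistential) :
    φ.exs.IsExistential := by
  induction k with
  | zero => exact hφ
  | succ k ih => exact ih hφ.ex

theorem isExistential_relabel {φ : L.BoundedFormula α k} (hφ : φ.IsExistential)
    (g : α → β ⊕ Fin n) : (φ.relabel g).IsExistential := by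
  induction hφ with
  | of_isQF h => exact (h.relabel g).isExistential
  | ex _ ih =>
    rw [relabel_ex]
    exact ih.ex

theorem isExistential_iExs [Finite β] {φ : L.Formula (α ⊕ β)}
    (hφ : BoundedFormula.IsExistential φ) : BoundedFormula.IsExistential (φ.iExs β) :=
  isExistential_exs (isExistential_relabel hφ _)

theorem isQF_iInf [Finite β] {f : β → L.BoundedFormula α k} (hf : ∀ b, (f b).IsQF) :
    (BoundedFormula.iInf f).IsQF := by
  dsimp only [BoundedFormula.iInf]
  induction Finset.toList _ with
  | nil => exact IsQF.top
  | cons b l ih => exact (hf b).inf ih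

open Classical in
/-- The formula `φ` or its negation, according to the truth value `p` it is meant to take. -/
noncomputable def literal (φ : L.BoundedFormula α k) (p : Prop) : L.BoundedFormula α k :=
  if p then φ else φ.not

theorem isQF_literal {φ : L.BoundedFormula α k} (hφ : φ.IsQF) (p : Prop) : (literal φ p).IsQF := by
  unfold literal
  split_ifs
  exacts [hφ, hφ.not]

theorem realize_literal {M : Type*} [L.Structure M] {φ : L.BoundedFormula α k} {p : Prop}
    {v : α → M} {xs : Fin k → M} :
    (literal φ p).Realize v xs ↔ (φ.Realize v xs ↔ p) := by
  unfold literal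
  split_ifs with hp <;> simp [hp]

instance : Countable Language.graph.Symbols := by
  have hrel : Function.Injective
      (Sigma.fst : (Σ n, Language.graph.Relations n) → ℕ) := by
    rintro ⟨_, r⟩ ⟨_, s⟩ rfl
    exact congrArg _ (Subsingleton.elim r s)
  have := hrel.countable
  exact inferInstanceAs (Countable (_ ⊕ _))

end Formulas

section Graphs

open Language

variable {V V' : Type*} {G : SimpleGraph V} {H : SimpleGraph V'}

/-- An embedding of graphs as an embedding of first-order structures, so that the preservation of
formulas under embeddings applies to it. -/
def structureEmbedding (f : G ↪g H) :
    @Language.Embedding Language.graph V V' G.structure H.structure :=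
  letI := G.structure
  letI := H.structure
  { toFun := f
    inj' := f.injective
    map_fun' := fun g => isEmptyElim g
    map_rel' := by
      rintro _ ⟨⟩ x
      exact f.map_adj_iff }

/-- The tuples `a` in `G` and `b` in `H` have the same quantifier-free type: the same equalities
and adjacencies hold between their entries. -/
def SameDiagram {I : Type*} (G : SimpleGraph V) (a : I → V) (H : SimpleGraph V') (b : I → V') :
    Prop :=
  ∀ i j, (a i = a j ↔ b i = b j) ∧ (G.Adj (a i) (a j) ↔ H.Adj (b i) (b j))

namespace SameDiagram

variable {I J : Type*} {a : I → V} {b : I → V'}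

theorem refl (G : SimpleGraph V) (a : I → V) : SameDiagram G a G a :=
  fun _ _ => ⟨Iff.rfl, Iff.rfl⟩

theorem comp (h : SameDiagram G a H b) (g : J → I) : SameDiagram G (a ∘ g) H (b ∘ g) :=
  fun _ _ => h _ _

/-- A map with the same diagram as the enumeration of `G` by its own vertices is an embedding. -/
def toEmbedding {f : V → V'} (h : SameDiagram G id H f) : G ↪g H :=
  ⟨⟨f, fun x y => (h x y).1.2⟩, fun {x y} => (h x y).2.symm⟩

end SameDiagram

/-- The conjunction of all the literals in the variables `I` that are true of the tuple `a`. -/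
noncomputable def diagramFormula {I : Type*} [Finite I] (G : SimpleGraph V) (a : I → V) :
    Language.graph.Formula I :=
  BoundedFormula.iInf fun p : I × I =>
    literal ((Term.var p.1).equal (Term.var p.2)) (a p.1 = a p.2) ⊓
      literal (adj.formula₂ (Term.var p.1) (Term.var p.2)) (G.Adj (a p.1) (a p.2))

variable {I : Type*} [Finite I]

theorem isQF_diagramFormula (G : SimpleGraph V) (a : I → V) : (diagramFormula G a).IsQF :=
  isQF_iInf fun _ => (isQF_literal (BoundedFormula.IsAtomic.equal _ _).isQF _).inf
    (isQF_literal (BoundedFormula.IsAtomic.rel _ _).isQF _)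

theorem realize_diagramFormula {a : I → V} {b : I → V'} :
    (letI := H.structure; (diagramFormula G a).Realize b) ↔ SameDiagram G a H b := by
  let := H.structure
  have realize_equal (i j : I) :
      Formula.Realize (L := Language.graph) ((Term.var i).equal (Term.var j)) b ↔ b i = b j :=
    Formula.realize_equal
  have realize_adj (i j : I) :
      Formula.Realize (adj.formula₂ (Term.var i) (Term.var j)) b ↔ H.Adj (b i) (b j) :=
    Formula.realize_rel₂
  unfold Formula.Realize at realize_equal realize_adj
  simp only [diagramFormula, Formula.Realize, BoundedFormula.realize_iInf,
    BoundedFormula.realize_inf, realize_literal, realize_equal, realize_adj, Prod.forall]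
  exact forall₂_congr fun _ _ => and_congr iff_comm iff_comm

end Graphs

section Types

open Language

variable {V V' : Type} {G : SimpleGraph V} {H : SimpleGraph V'} {n m : ℕ}

theorem Sat.map_embedding {φ : Language.graph.Formula (Fin n)} {a : Fin n → V} (h : Sat G φ a)
    (hφ : IsExistential φ) (f : G ↪g H) : Sat H φ (f ∘ a) := by
  let := G.structure
  let := H.structure
  have key := BoundedFormula.IsExistential.realize_embedding hφ (structureEmbedding f) h
  rwa [Subsingleton.elim (structureEmbedding f ∘ default) default] at key

theorem sat_relabel {φ : Language.graph.Formula (Fin n)} {g : Fin n → Fin m} {a : Fin m → V} :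
    Sat G (φ.relabel g) a ↔ Sat G φ (a ∘ g) := by
  let := G.structure
  exact Formula.realize_relabel

theorem existentialType_subset_map (f : G ↪g H) (a : Fin n → V) :
    existentialType G a ⊆ existentialType H (f ∘ a) :=
  fun _ h => ⟨h.1, h.2.map_embedding h.1 f⟩

theorem existentialType_map_eq {f : G ↪g H} (hf : ExistentiallyCompleteIn f) (a : Fin n → V) :
    existentialType H (f ∘ a) = existentialType G a :=
  Set.Subset.antisymm (fun _ h => ⟨h.1, hf _ _ _ h.1 h.2⟩) (existentialType_subset_map f a)

theorem restrictType_existentialType (a : Fin (n + 1) → V) :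
    restrictType (existentialType G a) = existentialType G (a ∘ Fin.castSucc) :=
  Set.ext fun _ => and_congr_right fun h =>
    (and_iff_right (isExistential_relabel h _)).trans sat_relabel

theorem exists_sameDiagram_of_subset {I : Type*} [Finite I] {a : Fin n → V} {b : Fin n → V'}
    (h : existentialType G a ⊆ existentialType H b) (c : I → V) :
    ∃ d : I → V', SameDiagram G (Sum.elim a c) H (Sum.elim b d) := by
  let φ := (diagramFormula G (Sum.elim a c)).iExs I
  have hφ : IsExistential φ := isExistential_iExs (isQF_diagramFormula _ _).isExistential
  have hGφ : Sat G φ a := by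
    let := G.structure
    exact Formula.realize_iExs.2 ⟨c, realize_diagramFormula.2 (.refl _ _)⟩
  have hHφ : Sat H φ b := (h ⟨hφ, hGφ⟩).2
  let := H.structure
  obtain ⟨d, hd⟩ := Formula.realize_iExs.1 hHφ
  exact ⟨d, realize_diagramFormula.1 hd⟩

theorem sameDiagram_of_existentialType_subset {a : Fin n → V} {b : Fin n → V'}
    (h : existentialType G a ⊆ existentialType H b) : SameDiagram G a H b := by
  obtain ⟨d, hd⟩ := exists_sameDiagram_of_subset h (Fin.elim0 : Fin 0 → V)
  exact hd.comp Sum.inl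

end Types

section Containment

open SimpleGraph

variable {W V V' : Type*} {K : SimpleGraph W} {G : SimpleGraph V} {H : SimpleGraph V'}

theorem isContained_of_range_subset (c : Copy K H) (e : G ↪g H)
    (hce : Set.range c ⊆ Set.range e) : K ⊑ G := by
  choose r hr using fun x => hce ⟨x, rfl⟩
  refine ⟨⟨⟨r, fun {x y} hxy => ?_⟩, fun x y hxy => c.injective ?_⟩⟩
  · rw [← e.map_adj_iff, hr, hr]
    exact c.toHom.map_adj hxy
  · exact (hr x).symm.trans ((congrArg e hxy).trans (hr y))

theorem isContained_or_isContained_of_sum (hK : K.Connected) (h : K ⊑ G ⊕g H) :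
    K ⊑ G ∨ K ⊑ H := by
  obtain ⟨c⟩ := h
  have reachable (x y) : (G ⊕g H).Reachable (c x) (c y) := (hK x y).map c.toHom
  obtain ⟨w⟩ := hK.nonempty
  rcases hw : c w with v | v
  · refine .inl (isContained_of_range_subset c Embedding.sumInl ?_)
    rintro _ ⟨x, rfl⟩
    rcases hx : c x with u | u
    · exact ⟨u, rfl⟩
    · exact (not_reachable_sum_inl_inr v u (hw ▸ hx ▸ reachable w x)).elim
  · refine .inr (isContained_of_range_subset c Embedding.sumInr ?_)
    rintro _ ⟨x, rfl⟩
    rcases hx : c x with u | u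
    · exact (not_reachable_sum_inl_inr u v (hx ▸ hw ▸ reachable x w)).elim
    · exact ⟨u, rfl⟩

end Containment

section DirectLimits

open SimpleGraph

variable {ι : Type*} [Preorder ι] [IsDirectedOrder ι] {V : ι → Type*} {G : ∀ i, SimpleGraph (V i)}
  (f : ∀ i j, i ≤ j → G i ↪g G j) [DirectedSystem V (f · · ·)]

/-- The direct limit of a directed system of graphs and embeddings. -/
def directLimit : SimpleGraph (DirectLimit V f) where
  Adj := DirectLimit.lift₂ f f (fun i => (G i).Adj) fun i j h _ _ =>
    propext (f i j h).map_adj_iff.symm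
  symm := ⟨DirectLimit.induction₂ f fun i x y h => by
    rw [DirectLimit.lift₂_def] at h ⊢
    exact h.symm⟩
  loopless := ⟨DirectLimit.induction f fun i x h => by
    rw [DirectLimit.lift₂_def] at h
    exact h.ne rfl⟩

theorem directLimit_adj {i : ι} {x y : V i} :
    (directLimit f).Adj ⟦⟨i, x⟩⟧ ⟦⟨i, y⟩⟧ ↔ (G i).Adj x y := by
  simp only [directLimit, DirectLimit.lift₂_def]

namespace directLimit

/-- The canonical embedding of a stage of a directed system of graphs in the direct limit. -/
def of (i : ι) : G i ↪g directLimit f where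
  toFun x := ⟦⟨i, x⟩⟧
  inj' := DirectLimit.mk_injective f (fun i j h => (f i j h).injective) i
  map_rel_iff' := directLimit_adj f

theorem of_map {i j : ι} (h : i ≤ j) (x : V i) : of f j (f i j h x) = of f i x :=
  DirectLimit.mk_apply (f := f) i j x h

theorem exists_of_eq (x : DirectLimit V f) : ∃ i y, of f i y = x := by
  obtain ⟨i, y, rfl⟩ := DirectLimit.exists_eq_mk f x
  exact ⟨i, y, rfl⟩

theorem exists_of_comp_eq [Nonempty ι] {I : Type*} [Finite I] (a : I → DirectLimit V f) :
    ∃ i, ∃ b : I → V i, of f i ∘ b = a := by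
  choose s y hy using fun k => exists_of_eq f (a k)
  obtain ⟨i, hi⟩ := Finite.exists_le s
  exact ⟨i, fun k => f _ _ (hi k) (y k), funext fun k => (of_map f (hi k) (y k)).trans (hy k)⟩

theorem exists_isContained [Nonempty ι] {W : Type*} [Finite W] {K : SimpleGraph W}
    (h : K ⊑ directLimit f) : ∃ i, K ⊑ G i := by
  obtain ⟨c⟩ := h
  obtain ⟨i, b, hb⟩ := exists_of_comp_eq f c
  refine ⟨i, isContained_of_range_subset c (of f i) ?_⟩
  rw [← hb]
  exact Set.range_comp_subset_range b (of f i)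

instance [Countable ι] [∀ i, Countable (V i)] : Countable (DirectLimit V f) :=
  inferInstanceAs (Countable (Quotient _))

end directLimit

end DirectLimits

section Chains

variable {V : ℕ → Type*} {G : ∀ n, SimpleGraph (V n)} (f : ∀ n, G n ↪g G (n + 1))

/-- The embeddings between the stages of a chain, obtained by composing those of consecutive
stages. -/
def chainMap (m n : ℕ) (h : m ≤ n) : G m ↪g G n where
  toFun := Nat.leRecOn h fun {k} => f k
  inj' := Nat.leRecOn_injective h _ fun k => (f k).injective
  map_rel_iff' := by
    intro x y
    induction n, h using Nat.le_induction with
    | base => simp [Nat.leRecOn_self]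
    | succ n h ih => simpa [Nat.leRecOn_succ h] using ih

theorem chainMap_succ (n : ℕ) (x : V n) : chainMap f n (n + 1) n.le_succ x = f n x :=
  Nat.leRecOn_succ' x

instance : DirectedSystem V (chainMap f · · ·) where
  map_self _ x := Nat.leRecOn_self x
  map_map _ _ _ hij hjk x := (Nat.leRecOn_trans hij hjk x).symm

theorem of_chainMap_succ (n : ℕ) (x : V n) :
    directLimit.of (chainMap f) (n + 1) (f n x) = directLimit.of (chainMap f) n x := by
  rw [← chainMap_succ, directLimit.of_map]

end Chains

section InductiveClasses

/-- A class of countable graphs closed under direct limits of countable chains. -/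
structure IsInductive (𝒦 : ∀ {V : Type}, SimpleGraph V → Prop) : Prop where
  countable {V : Type} {G : SimpleGraph V} (hG : 𝒦 G) : Countable V
  directLimit {V : ℕ → Type} {G : ∀ n, SimpleGraph (V n)} (f : ∀ m n, m ≤ n → G m ↪g G n)
    [DirectedSystem V (f · · ·)] (hG : ∀ n, 𝒦 (G n)) : 𝒦 (directLimit f)

/-- A graph of the class `𝒦` that contains `G` as an induced subgraph, by means of `emb`. -/
structure Extension (𝒦 : ∀ {V : Type}, SimpleGraph V → Prop) {V : Type} (G : SimpleGraph V) where
  {carrier : Type}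
  graph : SimpleGraph carrier
  emb : G ↪g graph
  mem : 𝒦 graph

variable {𝒦 : ∀ {V : Type}, SimpleGraph V → Prop} {V : Type} {G : SimpleGraph V}

namespace Extension

/-- A graph of `𝒦` as an extension of itself. -/
def refl (hG : 𝒦 G) : Extension 𝒦 G :=
  ⟨G, RelEmbedding.refl _, hG⟩

/-- An extension of an extension of `G`, as an extension of `G`. -/
def trans (X : Extension 𝒦 G) (Y : Extension 𝒦 X.graph) : Extension 𝒦 G :=
  ⟨Y.graph, Y.emb.comp X.emb, Y.mem⟩

/-- Extensions of `G` are compared by embeddings over `G`. -/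
instance : Preorder (Extension 𝒦 G) where
  le X Y := ∃ f : X.graph ↪g Y.graph, ∀ v, f (X.emb v) = Y.emb v
  le_refl _ := ⟨RelEmbedding.refl _, fun _ => rfl⟩
  le_trans := fun _ _ _ ⟨f, hf⟩ ⟨g, hg⟩ => ⟨g.comp f, fun v => (congrArg g (hf v)).trans (hg v)⟩

theorem le_trans_extension (X : Extension 𝒦 G) (Y : Extension 𝒦 X.graph) : X ≤ X.trans Y :=
  ⟨Y.emb, fun _ => rfl⟩

theorem bddAbove_range (h𝒦 : IsInductive 𝒦) {X : ℕ → Extension 𝒦 G} (hX : Monotone X) :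
    BddAbove (Set.range X) := by
  choose f hf using fun n : ℕ => hX n.le_succ
  have emb_eq (n v) : directLimit.of (chainMap f) n ((X n).emb v) =
      directLimit.of (chainMap f) 0 ((X 0).emb v) := by
    induction n with
    | zero => rfl
    | succ n ih => rw [← hf n v, of_chainMap_succ, ih]
  refine ⟨⟨directLimit (chainMap f), (directLimit.of _ 0).comp (X 0).emb,
    h𝒦.directLimit _ fun n => (X n).mem⟩, ?_⟩
  rintro _ ⟨n, rfl⟩
  exact ⟨directLimit.of (chainMap f) n, emb_eq n⟩

theorem exists_mem_of_isUpperSet (h𝒦 : IsInductive 𝒦) (hG : 𝒦 G) {I : Type*} [Countable I]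
    (D : I → Order.Cofinal (Extension 𝒦 G)) (hD : ∀ i, IsUpperSet (D i).carrier) :
    ∃ Y, ∀ i, Y ∈ D i := by
  let := Encodable.ofCountable I
  obtain ⟨Y, hY⟩ := bddAbove_range h𝒦 (Order.sequenceOfCofinals.monotone (refl hG) D)
  exact ⟨Y, fun i => hD i (hY ⟨_, rfl⟩) (Order.sequenceOfCofinals.encode_mem (refl hG) D i)⟩

end Extension

/-- A property of `n`-tuples of vertices in graphs. -/
abbrev TupleProp (n : ℕ) :=
  ∀ {V : Type}, SimpleGraph V → (Fin n → V) → Prop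

/-- A property of tuples in graphs of `𝒦` that is preserved by extensions in `𝒦`, and that every
tuple acquires in a suitable extension. -/
structure IsForceable (𝒦 : ∀ {V : Type}, SimpleGraph V → Prop) {n : ℕ} (S : TupleProp n) :
    Prop where
  map {V V' : Type} {G : SimpleGraph V} {H : SimpleGraph V'} (hG : 𝒦 G) (hH : 𝒦 H) (f : G ↪g H)
    {a : Fin n → V} (ha : S G a) : S H (f ∘ a)
  exists_extension {V : Type} {G : SimpleGraph V} (hG : 𝒦 G) (a : Fin n → V) :
    ∃ Y : Extension 𝒦 G, S Y.graph (Y.emb ∘ a)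

variable {T : ℕ → Type*} [∀ n, Countable (T n)] {S : ∀ {n}, T n → TupleProp n}

theorem exists_extension_forall_tuples (h𝒦 : IsInductive 𝒦)
    (hS : ∀ {n} (t : T n), IsForceable 𝒦 (S t)) (hG : 𝒦 G) :
    ∃ Y : Extension 𝒦 G, ∀ {n} (a : Fin n → V) (t : T n), S t Y.graph (Y.emb ∘ a) := by
  have := h𝒦.countable hG
  let D (i : Σ n, (Fin n → V) × T n) : Order.Cofinal (Extension 𝒦 G) :=
    { carrier := {Y | S i.2.2 Y.graph (Y.emb ∘ i.2.1)}
      isCofinal := fun X =>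
        have ⟨Z, hZ⟩ := (hS i.2.2).exists_extension X.mem (X.emb ∘ i.2.1)
        ⟨X.trans Z, hZ, X.le_trans_extension Z⟩ }
  have isUpperSet_D (i) : IsUpperSet (D i).carrier := fun X Z ⟨f, hf⟩ hX => by
    have hfa : f ∘ X.emb ∘ i.2.1 = Z.emb ∘ i.2.1 := funext fun k => hf (i.2.1 k)
    change S i.2.2 Z.graph (Z.emb ∘ i.2.1)
    rw [← hfa]
    exact (hS i.2.2).map X.mem Z.mem f hX
  obtain ⟨Y, hY⟩ := Extension.exists_mem_of_isUpperSet h𝒦 hG D isUpperSet_D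
  exact ⟨Y, fun a t => hY ⟨_, a, t⟩⟩

theorem exists_closed_extension (h𝒦 : IsInductive 𝒦)
    (hS : ∀ {n} (t : T n), IsForceable 𝒦 (S t)) (hG : 𝒦 G) :
    ∃ Y : Extension 𝒦 G, ∀ {n} (a : Fin n → Y.carrier) (t : T n), S t Y.graph a := by
  choose next hnext using fun X : Extension 𝒦 G => exists_extension_forall_tuples h𝒦 hS X.mem
  let X (k : ℕ) : Extension 𝒦 G := Nat.rec (.refl hG) (fun _ X => X.trans (next X)) k
  let f (k : ℕ) : (X k).graph ↪g (X (k + 1)).graph := (next (X k)).emb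
  have hlim : 𝒦 (directLimit (chainMap f)) := h𝒦.directLimit _ fun k => (X k).mem
  refine ⟨⟨directLimit (chainMap f), directLimit.of (chainMap f) 0, hlim⟩, fun a t => ?_⟩
  obtain ⟨k, b, rfl⟩ := directLimit.exists_of_comp_eq _ a
  have of_comp : directLimit.of (chainMap f) (k + 1) ∘ f k ∘ b = directLimit.of _ k ∘ b :=
    funext fun j => of_chainMap_succ f k (b j)
  rw [← of_comp]
  exact (hS t).map (X (k + 1)).mem hlim _ (hnext (X k) b t)

end InductiveClasses

section ForbiddenSubgraphs

open SimpleGraph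

universe u w

variable {ι : Type u} {W : ι → Type w} {C : ∀ i, SimpleGraph (W i)}
  {V V' : Type} {G : SimpleGraph V} {H : SimpleGraph V'}

theorem Omits.of_embedding (hH : Omits C H) (f : G ↪g H) : Omits C G :=
  fun i h => hH i (h.trans ⟨f.toCopy⟩)

theorem classG_empty (hC : ∀ i, Nonempty (W i)) : ClassG C (⊥ : SimpleGraph Empty) :=
  ⟨inferInstance, fun i ⟨c⟩ => (c (hC i).some).elim⟩

/-- The joint embedding property of `𝒢_C`: any two of its graphs are induced subgraphs of a third
one. -/
def HasJointEmbedding (C : ∀ i, SimpleGraph (W i)) : Prop :=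
  ∀ {V V' : Type} {G : SimpleGraph V} {H : SimpleGraph V'}, ClassG C G → ClassG C H →
    ∃ Y : Extension (ClassG C) G, Nonempty (H ↪g Y.graph)

theorem hasJointEmbedding_of_connected (hC : ∀ i, (C i).Connected) : HasJointEmbedding C := by
  rintro V V' G H ⟨_, hG⟩ ⟨_, hH⟩
  have omits_sum : Omits C (G ⊕g H) := fun i h =>
    (isContained_or_isContained_of_sum (hC i) h).elim (hG i) (hH i)
  exact ⟨⟨G ⊕g H, Embedding.sumInl, inferInstance, omits_sum⟩, ⟨Embedding.sumInr⟩⟩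

variable (C) [∀ i, Finite (W i)]

theorem isInductive_classG : IsInductive (ClassG C) where
  countable hG := hG.1
  directLimit f _ hG := by
    have (n : ℕ) := (hG n).1
    refine ⟨inferInstance, fun i h => ?_⟩
    obtain ⟨n, hn⟩ := directLimit.exists_isContained f h
    exact (hG n).2 i hn

theorem isInductive_classE : IsInductive (ClassE C) where
  countable hG := hG.1.1
  directLimit f _ hG := by
    refine ⟨(isInductive_classG C).directLimit f fun n => (hG n).1, fun V' K e hK m φ a hφ ha => ?_⟩
    obtain ⟨n, b, rfl⟩ := directLimit.exists_of_comp_eq f a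
    exact ((hG n).2 V' K (e.comp (directLimit.of f n)) hK m φ b hφ ha).map_embedding hφ _

end ForbiddenSubgraphs

section Ultrapowers

open SimpleGraph Filter

variable {V V' : Type*} {G : SimpleGraph V} {H : SimpleGraph V'} {I : Type*} (U : Ultrafilter I)

/-- The ultrapower of a graph: sequences of vertices up to equality on a set of the ultrafilter,
adjacent when their entries are adjacent on a set of the ultrafilter. -/
def ultrapower (G : SimpleGraph V) : SimpleGraph (Germ (U : Filter I) V) where
  Adj := Germ.LiftRel G.Adj
  symm := ⟨fun x y => Germ.inductionOn₂ x y fun _ _ h =>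
    Germ.liftRel_coe.2 ((Germ.liftRel_coe.1 h).mono fun _ => Adj.symm)⟩
  loopless := ⟨fun x => Germ.inductionOn x fun _ h =>
    have ⟨_, hi⟩ := (Germ.liftRel_coe.1 h).exists
    hi.ne rfl⟩

theorem ultrapower_adj_coe {x y : I → V} :
    (ultrapower U G).Adj x y ↔ ∀ᶠ i in (U : Filter I), G.Adj (x i) (y i) :=
  Germ.liftRel_coe

theorem sameDiagram_ultrapower {J : Type*} {c : J → V'} {F : J → I → V}
    (h : ∀ j k, ∀ᶠ i in (U : Filter I), (F j i = F k i ↔ c j = c k) ∧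
      (G.Adj (F j i) (F k i) ↔ H.Adj (c j) (c k))) :
    SameDiagram H c (ultrapower U G) fun j => (F j : Germ (U : Filter I) V) := by
  refine fun j k => ⟨?_, ?_⟩
  · rw [Germ.coe_eq, EventuallyEq, eventually_congr ((h j k).mono fun _ => And.left),
      eventually_const]
  · rw [ultrapower_adj_coe, eventually_congr ((h j k).mono fun _ => And.right), eventually_const]

theorem isContained_of_ultrapower {W : Type*} [Finite W] {K : SimpleGraph W}
    (h : K ⊑ ultrapower U G) : K ⊑ G := by
  obtain ⟨c⟩ := h
  have exists_rep (w) : ∃ r : I → V, (r : Germ (U : Filter I) V) = c w := Quotient.exists_rep _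
  choose r hr using exists_rep
  have eventually_adj : ∀ᶠ i in (U : Filter I), ∀ x y, K.Adj x y → G.Adj (r x i) (r y i) := by
    simp only [eventually_all]
    intro x y hxy
    rw [← ultrapower_adj_coe, hr, hr]
    exact c.toHom.map_adj hxy
  have eventually_ne : ∀ᶠ i in (U : Filter I), ∀ x y, x ≠ y → r x i ≠ r y i := by
    simp only [eventually_all]
    intro x y hxy
    refine Ultrafilter.eventually_not.2 fun h => hxy (c.injective ?_)
    exact (hr x).symm.trans ((Germ.coe_eq.2 h).trans (hr y))
  obtain ⟨i, hadj, hne⟩ := (eventually_adj.and eventually_ne).exists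
  exact ⟨⟨⟨fun x => r x i, fun {x y} => hadj x y⟩, fun x y => not_imp_not.1 (hne x y)⟩⟩

end Ultrapowers

section Amalgamation

open Filter

universe u w

variable {ι : Type u} {W : ι → Type w} {C : ∀ i, SimpleGraph (W i)}
  {V V' : Type} {G : SimpleGraph V} {H : SimpleGraph V'} {n : ℕ} {a : Fin n → V} {b : Fin n → V'}

/-- The embedding of a graph in its ultrapower by constant sequences. -/
def diagonal {I : Type*} (U : Ultrafilter I) (G : SimpleGraph V) : G ↪g ultrapower U G :=
  SameDiagram.toEmbedding (f := fun v => ((fun _ => v : I → V) : Germ (U : Filter I) V))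
    (sameDiagram_ultrapower U fun _ _ => .of_forall fun _ => ⟨Iff.rfl, Iff.rfl⟩)

theorem exists_local_embedding (h : existentialType H b ⊆ existentialType G a) (s : Finset V') :
    ∃ F : V' → V, SameDiagram H (Sum.elim b fun x : s => x) G (Sum.elim a fun x : s => F x) := by
  classical
  have nonempty (v : V') : Nonempty V :=
    have ⟨d, _⟩ := exists_sameDiagram_of_subset h fun _ : Unit => v
    ⟨d ()⟩
  obtain ⟨d, hd⟩ := exists_sameDiagram_of_subset h fun x : s => (x : V')
  let F (x : V') : V := if hx : x ∈ s then d ⟨x, hx⟩ else (nonempty x).some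
  have F_eq : (fun x : s => F x) = d := funext fun x => dif_pos x.2
  exact ⟨F, F_eq ▸ hd⟩

theorem exists_embedding_ultrapower (h : existentialType H b ⊆ existentialType G a) :
    ∃ (I : Type) (U : Ultrafilter I) (g : H ↪g ultrapower U G), g ∘ b = diagonal U G ∘ a := by
  classical
  choose F hF using exists_local_embedding h
  let U : Ultrafilter (Finset V') := Ultrafilter.of atTop
  have eventually_mem (j : Fin n ⊕ V') : ∀ᶠ s : Finset V' in (U : Filter (Finset V')),
      ∃ i : Fin n ⊕ s, i.map id Subtype.val = j := by
    apply Ultrafilter.of_le atTop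
    rcases j with i | x
    · exact Eventually.of_forall fun _ => ⟨.inl i, rfl⟩
    · filter_upwards [eventually_ge_atTop {x}] with s hs
      exact ⟨.inr ⟨x, hs (Finset.mem_singleton_self x)⟩, rfl⟩
  have key : SameDiagram H (Sum.elim b id) (ultrapower U G) fun j =>
      ((fun s => Sum.elim a (F s) j : Finset V' → V) : Germ (U : Filter (Finset V')) V) := by
    refine sameDiagram_ultrapower U fun j k => ?_
    filter_upwards [eventually_mem j, eventually_mem k] with s ⟨i, hi⟩ ⟨l, hl⟩
    subst hi hl
    have := hF s i l
    rcases i with i | x <;> rcases l with l | y <;> exact this.imp Iff.symm Iff.symm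
  exact ⟨_, U, (key.comp Sum.inr).toEmbedding, funext fun i => (key (.inr (b i)) (.inl i)).1.1 rfl⟩

theorem exists_countable_induce {U : Type*} {P : SimpleGraph U} [Countable V] [Countable V']
    (f : G ↪g P) (g : H ↪g P) : ∃ (s : Set U) (f' : G ↪g P.induce s) (g' : H ↪g P.induce s),
      s.Countable ∧ (∀ v, f' v = f v) ∧ ∀ v, g' v = g v :=
  ⟨Set.range f ∪ Set.range g, RelEmbedding.codRestrict _ f fun v => .inl ⟨v, rfl⟩,
    RelEmbedding.codRestrict _ g fun v => .inr ⟨v, rfl⟩,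
    (Set.countable_range f).union (Set.countable_range g), fun _ => rfl, fun _ => rfl⟩

theorem exists_amalgam [∀ i, Finite (W i)] (hG : ClassG C G) [Countable V']
    (h : existentialType H b ⊆ existentialType G a) :
    ∃ (Y : Extension (ClassG C) G) (g : H ↪g Y.graph), Y.emb ∘ a = g ∘ b := by
  have := hG.1
  obtain ⟨I, U, g, hg⟩ := exists_embedding_ultrapower h
  obtain ⟨s, f', g', hs, hf', hg'⟩ := exists_countable_induce (diagonal U G) g
  have omits_ultrapower : Omits C (ultrapower U G) :=
    fun i hi => hG.2 i (isContained_of_ultrapower U hi)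
  refine ⟨⟨(ultrapower U G).induce s, f', hs.to_subtype,
    omits_ultrapower.of_embedding (SimpleGraph.Embedding.induce s)⟩, g', funext fun i => ?_⟩
  exact Subtype.ext ((hf' _).trans ((congrFun hg i).symm.trans (hg' _).symm))

end Amalgamation

section ExistentiallyComplete

open Language

universe u w

variable {ι : Type u} {W : ι → Type w} {C : ∀ i, SimpleGraph (W i)}
  {V V' : Type} {G : SimpleGraph V} {H : SimpleGraph V'} {n : ℕ}

theorem ClassE.existentialType_map (hG : ClassE C G) (hH : ClassG C H) (f : G ↪g H)
    (a : Fin n → V) : existentialType H (f ∘ a) = existentialType G a :=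
  existentialType_map_eq (hG.2 V' H f hH) a

theorem ClassE.existentialType_empty_eq (hJ : HasJointEmbedding C) (hG : ClassE C G)
    (hH : ClassE C H) (a : Fin 0 → V) (b : Fin 0 → V') :
    existentialType G a = existentialType H b := by
  obtain ⟨Y, ⟨g⟩⟩ := hJ hG.1 hH.1
  rw [← hG.existentialType_map Y.mem Y.emb, ← hH.existentialType_map Y.mem g]
  exact congrArg _ (Subsingleton.elim _ _)

/-- Passing from `G` to a larger graph of `𝒢_C` does not make `φ(a)` true: either it is true in `G`
already, or it is true in no extension of `G`. A graph of `𝒢_C` is existentially complete when all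
existential formulas are decided in this sense at all its tuples. -/
def IsDecided (C : ∀ i, SimpleGraph (W i)) (φ : Language.graph.Formula (Fin n)) : TupleProp n :=
  fun G a => Sat G φ a ∨ ∀ Y : Extension (ClassG C) G, ¬ Sat Y.graph φ (Y.emb ∘ a)

theorem isForceable_isDecided {φ : Language.graph.Formula (Fin n)} (hφ : IsExistential φ) :
    IsForceable (ClassG C) (IsDecided C φ) where
  map _ _ f := .imp (fun h => h.map_embedding hφ f) fun h Y => h ⟨Y.graph, Y.emb.comp f, Y.mem⟩
  exists_extension {_ G} hG a := by
    by_cases h : ∃ Y : Extension (ClassG C) G, Sat Y.graph φ (Y.emb ∘ a)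
    · exact h.imp fun _ => .inl
    · exact ⟨.refl hG, .inr fun Y hY => h ⟨Y, hY⟩⟩

/-- An `(n + 1)`-type `p` extending the type of an `n`-tuple is realized by adding an entry to the
tuple. A graph of `ℰ_C` is `ℵ₀`-saturated when this holds for all its tuples and all `p`. -/
def IsRealizedOver (p : Set (Language.graph.Formula (Fin (n + 1)))) : TupleProp n :=
  fun {V} G a => restrictType p = existentialType G a →
    ∃ v : V, existentialType G (Fin.snoc a v : Fin (n + 1) → V) = p

variable [∀ i, Finite (W i)]

theorem exists_classE_extension (hG : ClassG C G) :
    ∃ Y : Extension (ClassG C) G, ClassE C Y.graph := by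
  obtain ⟨Y, hY⟩ := exists_closed_extension (isInductive_classG C)
    (T := fun n => {φ : Language.graph.Formula (Fin n) // IsExistential φ})
    (fun φ => isForceable_isDecided φ.2) hG
  refine ⟨Y, Y.mem, fun V' H f hH n φ a hφ ha => ?_⟩
  exact (hY a ⟨φ, hφ⟩).resolve_right fun h => h ⟨H, f, hH⟩ ha

theorem ClassE.exists_extension_realizing (hG : ClassE C G) {a : Fin n → V}
    {p : Set (Language.graph.Formula (Fin (n + 1)))} (hp : p ∈ typeSpace C (n + 1))
    (h : restrictType p = existentialType G a) :
    ∃ (Y : Extension (ClassE C) G) (v : Y.carrier),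
      existentialType Y.graph (Fin.snoc (Y.emb ∘ a) v : Fin (n + 1) → Y.carrier) = p := by
  obtain ⟨V', H, b, hH, rfl⟩ := hp
  rw [restrictType_existentialType] at h
  have := hH.1.1
  obtain ⟨Y, g, hg⟩ := exists_amalgam hG.1 h.subset
  obtain ⟨Z, hZ⟩ := exists_classE_extension Y.mem
  let g' : H ↪g Z.graph := Z.emb.comp g
  refine ⟨⟨Z.graph, (Y.trans Z).emb, hZ⟩, g' (b (Fin.last n)), ?_⟩
  have snoc_eq : Fin.snoc (Z.emb ∘ Y.emb ∘ a) (g' (b (Fin.last n))) = g' ∘ b := by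
    rw [hg]
    exact Fin.snoc_init_self (g' ∘ b)
  exact (congrArg _ snoc_eq).trans (hH.existentialType_map hZ.1 g' b)

theorem isForceable_isRealizedOver {p : Set (Language.graph.Formula (Fin (n + 1)))}
    (hp : p ∈ typeSpace C (n + 1)) : IsForceable (ClassE C) (IsRealizedOver p) where
  map hG hH f a h hpa := by
    rw [hG.existentialType_map hH.1] at hpa
    obtain ⟨v, hv⟩ := h hpa
    exact ⟨f v, by rw [← Fin.comp_snoc, hG.existentialType_map hH.1, hv]⟩
  exists_extension {_ G} hG a := by
    by_cases h : restrictType p = existentialType G a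
    · obtain ⟨Y, hY⟩ := hG.exists_extension_realizing hp h
      exact ⟨Y, fun _ => hY⟩
    · exact ⟨.refl hG, fun h' => (h h').elim⟩

theorem exists_isSaturated_extension (hcount : ∀ n, (typeSpace C n).Countable) (hG : ClassE C G) :
    ∃ Y : Extension (ClassE C) G, IsSaturated C Y.graph := by
  have (n : ℕ) : Countable (typeSpace C (n + 1)) := (hcount (n + 1)).to_subtype
  obtain ⟨Y, hY⟩ := exists_closed_extension (isInductive_classE C)
    (T := fun n => typeSpace C (n + 1)) (fun p => isForceable_isRealizedOver p.2) hG
  exact ⟨Y, Y.mem, fun n a p hp => hY a ⟨p, hp⟩⟩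

end ExistentiallyComplete

section BackAndForth

variable {V V' : Type*} {G : SimpleGraph V} {H : SimpleGraph V'}

theorem exists_set_of_exists_snoc {Z I : Type*} [Countable I] {R : ∀ {n}, (Fin n → Z) → Prop}
    {A : I → Set Z} (h₀ : R Fin.elim0)
    (hA : ∀ {n} {c : Fin n → Z}, R c → ∀ i, ∃ z ∈ A i, R (Fin.snoc c z : Fin (n + 1) → Z)) :
    ∃ S : Set Z, (∀ i, (S ∩ A i).Nonempty) ∧
      ∀ z ∈ S, ∀ z' ∈ S, ∃ (n : ℕ) (c : Fin n → Z) (j k : Fin n), R c ∧ c j = z ∧ c k = z' := by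
  let P := {s : Set Z // ∃ (n : ℕ) (c : Fin n → Z), R c ∧ Set.range c = s}
  let D (i : I) : Order.Cofinal P :=
    { carrier := {s | (s.1 ∩ A i).Nonempty}
      isCofinal := by
        rintro ⟨_, n, c, hc, rfl⟩
        obtain ⟨z, hz, hcz⟩ := hA hc i
        refine ⟨⟨_, n + 1, _, hcz, rfl⟩, ⟨z, ⟨Fin.last n, Fin.snoc_last ..⟩, hz⟩, ?_⟩
        rintro _ ⟨j, rfl⟩
        exact ⟨j.castSucc, Fin.snoc_castSucc ..⟩ }
  let := Encodable.ofCountable I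
  let p₀ : P := ⟨_, 0, _, h₀, rfl⟩
  let J := Order.idealOfCofinals p₀ D
  refine ⟨⋃ s ∈ J, s.1, fun i => ?_, fun z hz z' hz' => ?_⟩
  · obtain ⟨s, ⟨z, hzs, hzi⟩, hs⟩ := Order.cofinal_meets_idealOfCofinals p₀ D i
    exact ⟨z, Set.mem_biUnion hs hzs, hzi⟩
  · obtain ⟨s, hs, hzs⟩ := Set.mem_iUnion₂.1 hz
    obtain ⟨s', hs', hzs'⟩ := Set.mem_iUnion₂.1 hz'
    obtain ⟨⟨_, n, c, hc, rfl⟩, -, hle, hle'⟩ := J.directed s hs s' hs'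
    obtain ⟨j, hj⟩ := hle hzs
    obtain ⟨k, hk⟩ := hle' hzs'
    exact ⟨n, c, j, k, hc, hj, hk⟩

theorem SameDiagram.exists_embedding_comp_eq {I : Type*} {a : I → V} {b : I → V'}
    (h : SameDiagram G a H b) (ha : a.Surjective) : ∃ f : G ↪g H, f ∘ a = b := by
  obtain ⟨s, hs⟩ := ha.hasRightInverse
  have diagram_comp : SameDiagram G id H (b ∘ s) := hs.id ▸ h.comp s
  exact ⟨diagram_comp.toEmbedding, funext fun i => (h (s (a i)) i).1.1 (hs (a i))⟩

end BackAndForth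

section Saturated

universe u w

variable {ι : Type u} {W : ι → Type w} {C : ∀ i, SimpleGraph (W i)}
  {V V' : Type} {G : SimpleGraph V} {H : SimpleGraph V'} {n : ℕ}

theorem IsSaturated.exists_snoc (hG : IsSaturated C G) (hH : ClassE C H) {a : Fin n → V}
    {b : Fin n → V'} (h : existentialType H b = existentialType G a) (y : V') :
    ∃ x, existentialType H (Fin.snoc b y : Fin (n + 1) → V') =
      existentialType G (Fin.snoc a x : Fin (n + 1) → V) := by
  have snoc_comp : (Fin.snoc b y : Fin (n + 1) → V') ∘ Fin.castSucc = b :=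
    Fin.init_snoc (α := fun _ => V') y b
  obtain ⟨x, hx⟩ := hG.2 n a _ ⟨V', H, _, hH, rfl⟩
    ((restrictType_existentialType _).trans (snoc_comp ▸ h))
  exact ⟨x, hx.symm⟩

/-- The `n`-tuple of pairs `c` matches an `n`-tuple of `G` with an `n`-tuple of `H` of the same
existential type: a finite stage of the back-and-forth construction. -/
def IsMatching (G : SimpleGraph V) (H : SimpleGraph V') (c : Fin n → V × V') : Prop :=
  existentialType G (Prod.fst ∘ c) = existentialType H (Prod.snd ∘ c)

theorem IsSaturated.exists_isMatching_fst (hH : IsSaturated C H) (hG : ClassE C G)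
    {c : Fin n → V × V'} (h : IsMatching G H c) (x : V) :
    ∃ z : V × V', z.1 = x ∧ IsMatching G H (Fin.snoc c z : Fin (n + 1) → V × V') := by
  obtain ⟨y, hy⟩ := hH.exists_snoc hG h x
  refine ⟨(x, y), rfl, ?_⟩
  rwa [IsMatching, Fin.comp_snoc, Fin.comp_snoc]

theorem IsSaturated.exists_isMatching_snd (hG : IsSaturated C G) (hH : ClassE C H)
    {c : Fin n → V × V'} (h : IsMatching G H c) (y : V') :
    ∃ z : V × V', z.2 = y ∧ IsMatching G H (Fin.snoc c z : Fin (n + 1) → V × V') := by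
  obtain ⟨x, hx⟩ := hG.exists_snoc hH h.symm y
  refine ⟨(x, y), rfl, ?_⟩
  rw [IsMatching, Fin.comp_snoc, Fin.comp_snoc, hx]

theorem exists_set_sameDiagram {I : Type*} [Countable I] (hJ : HasJointEmbedding C)
    (hG : ClassE C G) (hH : ClassE C H) {A : I → Set (V × V')}
    (hA : ∀ {n} {c : Fin n → V × V'}, IsMatching G H c →
      ∀ i, ∃ z ∈ A i, IsMatching G H (Fin.snoc c z : Fin (n + 1) → V × V')) :
    ∃ S : Set (V × V'), (∀ i, (S ∩ A i).Nonempty) ∧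
      SameDiagram G (fun z : S => z.1.1) H fun z : S => z.1.2 := by
  obtain ⟨S, hS, hSdir⟩ := exists_set_of_exists_snoc (R := IsMatching G H)
    (hG.existentialType_empty_eq hJ hH _ _) hA
  refine ⟨S, hS, ?_⟩
  rintro ⟨_, hz⟩ ⟨_, hz'⟩
  obtain ⟨n, c, j, k, hc, rfl, rfl⟩ := hSdir _ hz _ hz'
  exact sameDiagram_of_existentialType_subset hc.subset j k

theorem IsSaturated.nonempty_embedding (hJ : HasJointEmbedding C) (hH : IsSaturated C H)
    (hG : ClassE C G) : Nonempty (G ↪g H) := by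
  have := hG.1.1
  obtain ⟨S, hS, hdiag⟩ := exists_set_sameDiagram hJ hG hH.1
    fun hc => hH.exists_isMatching_fst hG hc
  obtain ⟨f, -⟩ := hdiag.exists_embedding_comp_eq fun x =>
    have ⟨z, hz, hx⟩ := hS x
    ⟨⟨z, hz⟩, hx⟩
  exact ⟨f⟩

theorem IsSaturated.nonempty_iso (hJ : HasJointEmbedding C) (hG : IsSaturated C G)
    (hH : IsSaturated C H) : Nonempty (G ≃g H) := by
  have := hG.1.1.1
  have := hH.1.1.1
  let A : V ⊕ V' → Set (V × V') := Sum.elim (fun x => {z | z.1 = x}) fun y => {z | z.2 = y}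
  obtain ⟨S, hS, hdiag⟩ := exists_set_sameDiagram (A := A) hJ hG.1 hH.1
    fun hc => Sum.rec (hH.exists_isMatching_fst hG.1 hc) (hG.exists_isMatching_snd hH.1 hc)
  have fst_surjective : (fun z : S => z.1.1).Surjective := fun x =>
    have ⟨z, hz, hx⟩ := hS (.inl x)
    ⟨⟨z, hz⟩, hx⟩
  have snd_surjective : (fun z : S => z.1.2).Surjective := fun y =>
    have ⟨z, hz, hy⟩ := hS (.inr y)
    ⟨⟨z, hz⟩, hy⟩
  obtain ⟨f, hf⟩ := hdiag.exists_embedding_comp_eq fst_surjective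
  exact ⟨RelIso.ofSurjective f (.of_comp (hf ▸ snd_surjective))⟩

theorem typeSpace_countable_of_isUniversalIn (hG : IsUniversalIn (ClassE C) G) (n : ℕ) :
    (typeSpace C n).Countable := by
  have := hG.1.1.1
  refine (Set.countable_range fun a : Fin n → V => existentialType G a).mono ?_
  rintro _ ⟨V', H, b, hH, rfl⟩
  obtain ⟨f⟩ := hG.2 V' H hH
  exact ⟨f ∘ b, hH.existentialType_map hG.1.1 f b⟩

end Saturated

end ForbiddenGraphs

open ForbiddenGraphs in
theorem theorem2_general {ι : Type*} {W : ι → Type*} [∀ i, Finite (W i)]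
    (C : ∀ i, SimpleGraph (W i)) (hne : ∀ i, Nonempty (W i)) (hJ : HasJointEmbedding C) :
    List.TFAE [
      ∃ (V : Type) (G : SimpleGraph V), IsUniversalIn (ClassG C) G,
      ∃ (V : Type) (G : SimpleGraph V), IsUniversalIn (ClassE C) G,
      ∃ (V : Type) (G : SimpleGraph V), IsSaturated C G ∧
        ∀ (V' : Type) (G' : SimpleGraph V'), IsSaturated C G' → Nonempty (G' ≃g G),
      ∀ n : ℕ, (typeSpace C n).Countable] := by
  tfae_have 1 → 2 := by
    rintro ⟨V, G, hG, huniv⟩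
    obtain ⟨Y, hY⟩ := exists_classE_extension hG
    exact ⟨_, Y.graph, hY, fun V' H hH => (huniv V' H hH.1).map Y.emb.comp⟩
  tfae_have 2 → 1 := by
    rintro ⟨V, G, hG, huniv⟩
    refine ⟨V, G, hG.1, fun V' H hH => ?_⟩
    obtain ⟨Y, hY⟩ := exists_classE_extension hH
    exact (huniv _ Y.graph hY).map fun f => f.comp Y.emb
  tfae_have 2 → 4 := fun ⟨_, _, hG⟩ => typeSpace_countable_of_isUniversalIn hG
  tfae_have 4 → 3 := by
    intro hcount
    obtain ⟨X, hX⟩ := exists_classE_extension (classG_empty hne)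
    obtain ⟨Y, hY⟩ := exists_isSaturated_extension hcount hX
    exact ⟨_, Y.graph, hY, fun V' G' hG' => hG'.nonempty_iso hJ hY⟩
  tfae_have 3 → 2 := fun ⟨V, G, hG, _⟩ =>
    ⟨V, G, hG.1, fun _ _ hH => hG.nonempty_embedding hJ hH⟩
  tfae_finish

open ForbiddenGraphs in
theorem theorem2 {ι : Type*} [Finite ι] {W : ι → Type*} [∀ i, Finite (W i)]
    (C : ∀ i, SimpleGraph (W i)) (hC : ∀ i, (C i).Connected) :
    List.TFAE [
      ∃ (V : Type) (G : SimpleGraph V), IsUniversalIn (ClassG C) G,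
      ∃ (V : Type) (G : SimpleGraph V), IsUniversalIn (ClassE C) G,
      ∃ (V : Type) (G : SimpleGraph V), IsSaturated C G ∧
        ∀ (V' : Type) (G' : SimpleGraph V'), IsSaturated C G' → Nonempty (G' ≃g G),
      ∀ n : ℕ, (typeSpace C n).Countable] :=
  theorem2_general C (fun i => (hC i).nonempty) (hasJointEmbedding_of_connected hC)
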